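/- Let $d\ge 0$ be an integer. For $K\subset\mathbb R$ let $\mathcal P_d(K)$ be the set of monic polynomials of degree $d$ all of whose complex roots lie in $K$, and write $\lambda_1(p)\ge\dots\ge\lambda_d(p)$ for the roots of $p\in\mathcal P_d(\mathbb R)$, counted with multiplicity. For $p,q\in\mathcal P_d(\mathbb R)$ write $p\ll q$ if $\lambda_i(p)\le\lambda_i(q)$ for $i=1,\dots,d$. For a monic polynomial $p$ of degree $d$ define $\tilde e_k(p)$, $0\le k\le d$, by $$p(x)=\sum_{k=0}^d(-1)^k\binom dk\tilde e_k(p)\,x^{d-k},$$ and define the monic polynomials $p\boxplus_d q$ and $p\boxtimes_d q$ of degree $d$ by $$\tilde e_k(p\boxplus_d q)=\sum_{j=0}^k\binom kj\tilde e_j(p)\tilde e_{k-j}(q),\qquad \tilde e_k(p\boxtimes_d q)=\tilde e_k(p)\,\tilde e_k(q)\qquad(0\le k\le d).$$ For $1\le k\le d$ let $\partial_{k|d}\,p:=\dfrac{p^{(d-k)}}{d(d-1)\cdots(k+1)}$, a monic polynomial of degree $k$. For $p\in\mathcal P_d(\mathbb R_{\ge0})$ let $\Phi_d(p):=\lim_{n\to\infty}\bigl(p^{\boxtimes_d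 n}\bigr)^{\langle 1/n\rangle}$ (limit of each coefficient), where $p^{\boxtimes_d n}$ is the $n$-fold convolution $p\boxtimes_d\cdots\boxtimes_d p$, and $g^{\langle c\rangle}$ is the monic polynomial with roots $\lambda_1(g)^c,\dots,\lambda_d(g)^c$, for $g\in\mathcal P_d(\mathbb R_{\ge0})$ and $c>0$. **Theorem.** Let $p,q\in\mathcal P_d(\mathbb R)$ with $p\ll q$. 1. If $r\in\mathcal P_d(\mathbb R)$, then $p\boxplus_d r$ and $q\boxplus_d r$ lie in $\mathcal P_d(\mathbb R)$ and $p\boxplus_d r\ll q\boxplus_d r$. 2. If $r\in\mathcal P_d(\mathbb R_{\ge0})$, then $p\boxtimes_d r$ and $q\boxtimes_d r$ lie in $\mathcal P_d(\mathbb R)$ and $p\boxtimes_d r\ll q\boxtimes_d r$. 3. For every $k=1,\dots,d$, the polynomials $\partial_{k|d}\,p$ and $\partial_{k|d}\,q$ lie in $\mathcal P_k(\mathbb R)$ and $\partial_{k|d}\,p\ll\partial_{k|d}\,q$. 4. If moreover $p,q\in\mathcal P_d(\mathbb R_{\ge0})$, then the limits $\Phi_d(p)$ and $\Phi_d(q)$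 exist and lie in $\mathcal P_d(\mathbb R_{\ge0})$, and $\Phi_d(p)\ll\Phi_d(q)$. -/

import Mathlib

open Polynomial Filter Topology

noncomputable section

namespace FiniteFree

/-- The set `P_d(K)`, for `K` a set of real numbers: monic polynomials of degree `d` all of whose
(complex) roots lie in `K`. Such a polynomial has real coefficients and is a product of linear
factors over `ℝ`. -/
def polys (d : ℕ) (K : Set ℝ) : Set ℝ[X] :=
  {p | p.Monic ∧ p.natDegree = d ∧ p.Splits ∧ ∀ x, p.IsRoot x → x ∈ K}

/-- The `(i + 1)`-st largest root of `p`, counted with multiplicity (the index starts at `0`).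
It is meant for `i` less than the number of roots; otherwise the value is `0`. -/
def orderedRoot (p : ℝ[X]) (i : ℕ) : ℝ :=
  (p.roots.sort (· ≥ ·)).getD i 0

/-- The order `p ≪ q` on the set `P_d(ℝ)` of real-rooted monic polynomials of degree `d`. -/
def RootLE (d : ℕ) (p q : ℝ[X]) : Prop :=
  p ∈ polys d Set.univ ∧ q ∈ polys d Set.univ ∧
    ∀ i < d, orderedRoot p i ≤ orderedRoot q i

/-- The normalized coefficients `ẽ_k` of a monic polynomial of degree `d`, that is, the numbers with
`p = ∑ k ∈ {0, …, d}, (-1) ^ k * (d.choose k) * ẽ_k * X ^ (d - k)`. -/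
def normCoeff (d : ℕ) (p : ℝ[X]) (k : ℕ) : ℝ :=
  (-1) ^ k * p.coeff (d - k) / (d.choose k : ℝ)

/-- The polynomial with prescribed normalized coefficients `a 0, …, a d`. -/
def ofNormCoeff (d : ℕ) (a : ℕ → ℝ) : ℝ[X] :=
  ∑ k ∈ Finset.range (d + 1), monomial (d - k) ((-1) ^ k * (d.choose k : ℝ) * a k)

/-- `ẽ_k` is the normalized `k`-th elementary symmetric polynomial of the roots. -/
theorem normCoeff_eq_esymm {d : ℕ} {p : ℝ[X]} (hp : p ∈ polys d Set.univ) {k : ℕ} (hk : k ≤ d) :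
    normCoeff d p k = p.roots.esymm k / (d.choose k : ℝ) := by
  obtain ⟨hm, hd, hs, -⟩ := hp
  have h := coeff_eq_esymm_roots_of_splits hs (k := d - k) (by omega)
  rw [hm.leadingCoeff, hd, Nat.sub_sub_self hk, one_mul] at h
  rw [normCoeff, h, ← mul_assoc, ← mul_pow]
  norm_num

/-- `ofNormCoeff` does have the prescribed normalized coefficients. -/
theorem normCoeff_ofNormCoeff {d : ℕ} (a : ℕ → ℝ) {k : ℕ} (hk : k ≤ d) :
    normCoeff d (ofNormCoeff d a) k = a k := by
  have h : (ofNormCoeff d a).coeff (d - k) = (-1) ^ k * (d.choose k : ℝ) * a k := by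
    rw [ofNormCoeff, finsetSum_coeff, Finset.sum_eq_single k]
    · simp
    · intro j hj hjk
      rw [Finset.mem_range] at hj
      rw [coeff_monomial, if_neg (by omega)]
    · intro h
      simp at h
      omega
  have hc : (d.choose k : ℝ) ≠ 0 := by exact_mod_cast (Nat.choose_pos hk).ne'
  rw [normCoeff, h, div_eq_iff hc, ← mul_assoc, ← mul_assoc, ← mul_pow]
  norm_num
  ring

/-- The finite free additive convolution `p ⊞_d q`. -/
def addConv (d : ℕ) (p q : ℝ[X]) : ℝ[X] :=
  ofNormCoeff d fun k =>
    ∑ j ∈ Finset.range (k + 1), (k.choose j : ℝ) * normCoeff d p j * normCoeff d q (k - j)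

/-- The finite free multiplicative convolution `p ⊠_d q`. -/
def mulConv (d : ℕ) (p q : ℝ[X]) : ℝ[X] :=
  ofNormCoeff d fun k => normCoeff d p k * normCoeff d q k

/-- The convolution powers of `p` for `⊠_d`; the unit of `⊠_d` is `(X - 1) ^ d`. -/
def mulConvPow (d : ℕ) (p : ℝ[X]) : ℕ → ℝ[X]
  | 0 => (X - 1) ^ d
  | n + 1 => mulConv d (mulConvPow d p n) p

/-- The monic polynomial whose roots are the `c`-th powers of the (nonnegative) roots of `p`. -/
def rootPow (p : ℝ[X]) (c : ℝ) : ℝ[X] :=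
  (p.roots.map fun x => X - C (x ^ c)).prod

/-- The sequence whose limit is `Φ_d(p)`: take the `n`-th convolution power of `p` for `⊠_d`
and replace its roots by their `n`-th roots. -/
def phiSeq (d : ℕ) (p : ℝ[X]) (n : ℕ) : ℝ[X] :=
  rootPow (mulConvPow d p n) (1 / (n : ℝ))

/-- Convergence of polynomials (of bounded degree): convergence of every coefficient. -/
def PolyTendsto (u : ℕ → ℝ[X]) (P : ℝ[X]) : Prop :=
  ∀ k, Tendsto (fun n => (u n).coeff k) atTop (𝓝 (P.coeff k))

/-- The polynomial `Φ_d(p)`, the coefficientwise limit of `phiSeq d p`. -/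
def Phi (d : ℕ) (p : ℝ[X]) : ℝ[X] :=
  ∑ k ∈ Finset.range (d + 1), monomial k (limUnder atTop fun n => (phiSeq d p n).coeff k)

/-- The normalized `(d - k)`-th derivative of `p`, divided by `d (d - 1) ⋯ (k + 1)`,
which takes a monic polynomial of degree `d` to a monic polynomial of degree `k ≤ d`. -/
def normDeriv (d k : ℕ) (p : ℝ[X]) : ℝ[X] :=
  C ((d.descFactorial (d - k) : ℝ)⁻¹) * derivative^[d - k] p

end FiniteFree

end

/-! All three operators (`addConv` and `mulConv` with `r` fixed, and `normDeriv`) share one feature: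
for each z in the upper half-plane, p ↦ (T p)(z) is a linear functional L that vanishes on no stable
polynomial of degree d. For the convolutions, L is the apolarity pairing with a product of linear
factors built from z and the roots of `r`, and nonvanishing is a Grace-type theorem
(`Stable.pairing_ne_zero`), proved by iterating polar derivatives.

This feature gives real-rootedness at once. It also gives monotonicity: by `Stable`-ness of (X - c)
S for Im c ≤ 0, the values F = L(X S) and G = L(S) satisfy Im(F conj G) ≥ 0. Moving one root from a
to b ≥ a changes F - aG into F - bG, and Im((F - aG) conj(F - bG)) = (a - b) Im(F conj G) ≤ 0.
Following arguments from i∞ down to the real line turns this sign into an inequality of root counts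
(`countP_le_countP`). Roots are moved one at a time.

For Φ, normalized coefficients are multiplicative under ⊠, and ẽ_k lies within a factor `d.choose k`
of the product of the k largest roots. Taking n-th roots kills that factor, so the products converge
to ẽ_k(p) and the roots to the ratios ẽ_{i+1}/ẽ_i. Monotonicity passes to the limit. -/

namespace FiniteFree

/-! ### Apolarity, polar derivatives and Grace's theorem -/

/-- A complex polynomial is (half-plane) stable if it has no zero in the open upper half-plane. -/
def Stable (P : ℂ[X]) : Prop :=
  ∀ z : ℂ, 0 < z.im → P.eval z ≠ 0

/-- The apolarity pairing on polynomials of degree at most `d`, up to signs: it is the evaluation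
of the polarization of `P` at the linear factors of `Q`. -/
noncomputable def pairing (d : ℕ) (Q : ℂ[X]) : ℂ[X] →ₗ[ℂ] ℂ where
  toFun P := ∑ j ∈ Finset.range (d + 1), P.coeff j * Q.coeff j / (d.choose j : ℂ)
  map_add' P R := by
    simp only [coeff_add, add_mul, add_div, Finset.sum_add_distrib]
  map_smul' c P := by
    simp only [coeff_smul, smul_eq_mul, RingHom.id_apply, Finset.mul_sum, mul_assoc, mul_div_assoc]

theorem pairing_apply (d : ℕ) (P Q : ℂ[X]) :
    pairing d Q P = ∑ j ∈ Finset.range (d + 1), P.coeff j * Q.coeff j / (d.choose j : ℂ) := rfl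

/-- The polar derivative of a polynomial of degree `n + 1`, with pole at `u / v`
(multiplied by `v / (n + 1)`). -/
noncomputable def polar (n : ℕ) (u v : ℂ) (P : ℂ[X]) : ℂ[X] :=
  C v * P + C (u / (n + 1)) * derivative P - C (v / (n + 1)) * (X * derivative P)

theorem coeff_polar (n : ℕ) (u v : ℂ) (P : ℂ[X]) (j : ℕ) :
    (polar n u v P).coeff j =
      v * P.coeff j * ((n + 1 - j) / (n + 1)) + u * P.coeff (j + 1) * ((j + 1) / (n + 1)) := by
  have h : (n + 1 : ℂ) ≠ 0 := by exact_mod_cast n.succ_ne_zero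
  rcases j with _ | j
  · simp [polar, coeff_derivative]
    field_simp
  · simp [polar, coeff_derivative, coeff_X_mul]
    field_simp
    ring

/-- Fixing one argument of the polarization of `P` is taking a polar derivative, so linear factors
of the second polynomial can be removed one by one. -/
theorem pairing_succ (n : ℕ) (u v : ℂ) (P Q : ℂ[X]) (hQ : Q.natDegree ≤ n) :
    pairing (n + 1) ((C v + C u * X) * Q) P = pairing n Q (polar n u v P) := by
  have hn : (n + 1 : ℂ) ≠ 0 := by exact_mod_cast n.succ_ne_zero
  have hQn : Q.coeff (n + 1) = 0 := coeff_eq_zero_of_natDegree_lt (by omega)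
  rw [pairing_apply, pairing_apply]
  have e1 : ∀ j ∈ Finset.range (n + 1), (polar n u v P).coeff j * Q.coeff j / (n.choose j : ℂ) =
      P.coeff j * (v * Q.coeff j) / ((n + 1).choose j : ℂ) +
        P.coeff (j + 1) * (u * Q.coeff j) / ((n + 1).choose (j + 1) : ℂ) := by
    intro j hj
    rw [Finset.mem_range] at hj
    have c0 : (n.choose j : ℂ) ≠ 0 := by exact_mod_cast (Nat.choose_pos (by omega)).ne'
    have c1 : ((n + 1).choose j : ℂ) ≠ 0 := by exact_mod_cast (Nat.choose_pos (by omega)).ne'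
    have c2 : ((n + 1).choose (j + 1) : ℂ) ≠ 0 := by
      exact_mod_cast (Nat.choose_pos (by omega)).ne'
    have h1 : ((n + 1).choose j : ℂ) * (n + 1 - j) = (n + 1) * n.choose j := by
      have := Nat.choose_mul_succ_eq n j
      have h2 : ((n + 1 - j : ℕ) : ℂ) = n + 1 - j := by
        rw [Nat.cast_sub (by omega)]; push_cast; ring
      rw [← h2]
      exact_mod_cast (by linarith : (n + 1).choose j * (n + 1 - j) = (n + 1) * n.choose j)
    have h2 : ((n + 1).choose (j + 1) : ℂ) * (j + 1) = (n + 1) * n.choose j := by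
      exact_mod_cast (Nat.add_one_mul_choose_eq n j).symm
    have r1 : ((n : ℂ) + 1 - j) / (n + 1) = n.choose j / (n + 1).choose j := by
      rw [div_eq_div_iff hn c1]; linear_combination h1
    have r2 : ((j : ℂ) + 1) / (n + 1) = n.choose j / (n + 1).choose (j + 1) := by
      rw [div_eq_div_iff hn c2]; linear_combination h2
    rw [coeff_polar, r1, r2]
    field_simp
  rw [Finset.sum_congr rfl e1, Finset.sum_add_distrib]
  have e2 : ∀ j, ((C v + C u * X) * Q).coeff j =
      v * Q.coeff j + u * (X * Q).coeff j := by
    intro j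
    rw [add_mul, coeff_add, coeff_C_mul, mul_assoc, coeff_C_mul]
  simp only [e2, mul_add, add_div, Finset.sum_add_distrib]
  congr 1
  · rw [Finset.sum_range_succ, hQn]
    simp
  · rw [Finset.sum_range_succ']
    simp [coeff_X_mul]

/-- Images of the lower half-plane under `ρ ↦ 1 / (z - ρ)`, `Im z = y`, lie in a disc; this is
Jensen's inequality for sums of points of that disc. -/
theorem multiset_sum_mem_disc {y : ℝ} (hy : 0 < y) (s : Multiset ℂ)
    (h : ∀ w ∈ s, y * Complex.normSq w + w.im ≤ 0) :
    y * Complex.normSq s.sum + s.card * s.sum.im ≤ 0 := by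
  induction s using Multiset.induction with
  | empty => simp
  | cons w s ih =>
    have h1 := h w (Multiset.mem_cons_self w s)
    have h2 := ih fun x hx => h x (Multiset.mem_cons_of_mem hx)
    rcases Multiset.empty_or_exists_mem s with rfl | ⟨a, ha⟩
    · simpa using h1
    have hc : (0 : ℝ) < s.card := by exact_mod_cast Multiset.card_pos_iff_exists_mem.2 ⟨a, ha⟩
    simp only [Multiset.sum_cons, Multiset.card_cons, Complex.normSq_apply, Complex.add_re,
      Complex.add_im] at *
    push_cast
    generalize s.sum = S at *
    generalize (s.card : ℝ) = m at *
    -- The convexity defect y |S - m w|²: it is exactly the gap between the weighted sum of `h1` and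
    -- `h2` and m times the goal.
    have h3 : 0 ≤ y * ((S.re - m * w.re) ^ 2 + (S.im - m * w.im) ^ 2) := by positivity
    have h4 : m * (y * ((w.re + S.re) * (w.re + S.re) + (w.im + S.im) * (w.im + S.im)) +
        (m + 1) * (w.im + S.im)) ≤ 0 := by
      nlinarith [mul_le_mul_of_nonneg_left h1 (by positivity : 0 ≤ m * (m + 1)),
        mul_le_mul_of_nonneg_left h2 (by positivity : 0 ≤ m + 1)]
    exact nonpos_of_mul_nonpos_right h4 hc

theorem multiset_sum_im_neg {s : Multiset ℂ} (hs : s ≠ 0) (h : ∀ w ∈ s, w.im < 0) :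
    s.sum.im < 0 := by
  induction s using Multiset.induction with
  | empty => exact absurd rfl hs
  | cons w s ih =>
    rw [Multiset.sum_cons, Complex.add_im]
    have h1 := h w (Multiset.mem_cons_self w s)
    rcases eq_or_ne s 0 with rfl | hs'
    · simpa using h1
    · linarith [ih hs' fun x hx => h x (Multiset.mem_cons_of_mem hx)]

theorem Stable.im_le_zero {P : ℂ[X]} (hP : Stable P) {ρ : ℂ} (h : ρ ∈ P.roots) : ρ.im ≤ 0 := by
  by_contra! hc
  exact hP ρ hc (isRoot_of_mem_roots h)

/-- At a zero z, the sum S of 1/(z - ρ) over the roots satisfies u S = v (z S - (n+1)). Multiplying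
by conj S and taking imaginary parts gives Im u |S|² = v (Im z |S|² + (n+1) Im S), which is ≤ 0 by
the disc inequality, while the left side is positive. -/
theorem Stable.polar {n : ℕ} {P : ℂ[X]} (hP : Stable P) (hd : P.natDegree = n + 1) {u : ℂ}
    {v : ℝ} (hu : 0 < u.im) (hv : 0 ≤ v) : Stable (polar n u v P) := by
  intro z hz h0
  have hPz := hP z hz
  have hn : (n + 1 : ℂ) ≠ 0 := by exact_mod_cast n.succ_ne_zero
  set S := (P.roots.map fun ρ => 1 / (z - ρ)).sum with hS
  have hder : P.derivative.eval z = P.eval z * S := by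
    rw [hS, ← (IsAlgClosed.splits P).eval_derivative_div_eval_of_ne_zero hPz]
    field_simp
  have hcard : P.roots.card = n + 1 := by
    rw [← hd]; exact (IsAlgClosed.splits P).natDegree_eq_card_roots.symm
  have hkey : u * S = v * (z * S - (n + 1)) := by
    have h1 : P.eval z * ((n + 1) * v + u * S - v * z * S) = 0 := by
      simp only [FiniteFree.polar, eval_sub, eval_add, eval_mul, eval_C, eval_X, hder] at h0
      field_simp at h0
      linear_combination h0
    rcases mul_eq_zero.1 h1 with h | h
    · exact absurd h hPz
    · linear_combination h
  have hw : ∀ w ∈ P.roots.map (fun ρ => 1 / (z - ρ)), z.im * Complex.normSq w + w.im ≤ 0 ∧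
      w.im < 0 := by
    intro w hw
    obtain ⟨ρ, hρ, rfl⟩ := Multiset.mem_map.1 hw
    have h1 := hP.im_le_zero hρ
    have h2 : 0 < (z - ρ).im := by rw [Complex.sub_im]; linarith
    have h3 : 0 < Complex.normSq (z - ρ) := by
      rw [Complex.normSq_pos]; intro h; rw [h] at h2; simp at h2
    rw [one_div, Complex.inv_im, Complex.normSq_inv]
    constructor
    · rw [← div_eq_mul_inv, ← add_div]
      apply div_nonpos_of_nonpos_of_nonneg _ h3.le
      rw [Complex.sub_im]; linarith
    · exact div_neg_of_neg_of_pos (by linarith) h3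
  have hdisc := multiset_sum_mem_disc hz _ fun w h => (hw w h).1
  have hneg : S.im < 0 := multiset_sum_im_neg
    (by rw [← Multiset.card_pos, Multiset.card_map, hcard]; omega) fun w h => (hw w h).2
  rw [Multiset.card_map, hcard, ← hS] at hdisc
  push_cast at hdisc
  have hre := congrArg Complex.re hkey
  have him := congrArg Complex.im hkey
  simp only [Complex.mul_re, Complex.mul_im, Complex.sub_re, Complex.sub_im, Complex.ofReal_re,
    Complex.ofReal_im, Complex.add_re, Complex.add_im, Complex.natCast_re, Complex.natCast_im,
    Complex.one_re, Complex.one_im] at hre him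
  have h1 : u.im * Complex.normSq S = v * (z.im * Complex.normSq S + (n + 1) * S.im) := by
    rw [Complex.normSq_apply]
    linear_combination him * S.re - hre * S.im
  have h2 : 0 < Complex.normSq S := by
    rw [Complex.normSq_pos]; intro h; rw [h] at hneg; simp at hneg
  nlinarith [mul_pos hu h2, mul_nonneg hv (sub_nonneg.2 hdisc)]

/-- The new top coefficient is the old one times u - (v/(n+1)) Σρ. Its second factor has positive
imaginary part because the roots ρ lie in the closed lower half-plane. -/
theorem Stable.natDegree_polar {n : ℕ} {P : ℂ[X]} (hP : Stable P) (hd : P.natDegree = n + 1)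
    {u : ℂ} {v : ℝ} (hu : 0 < u.im) (hv : 0 ≤ v) :
    (FiniteFree.polar n u v P).natDegree = n := by
  have hn : (n + 1 : ℂ) ≠ 0 := by exact_mod_cast n.succ_ne_zero
  have hlc : P.leadingCoeff ≠ 0 := by
    rw [Ne, leadingCoeff_eq_zero]; rintro rfl; simp at hd
  apply natDegree_eq_of_le_of_coeff_ne_zero
  · rw [natDegree_le_iff_coeff_eq_zero]
    intro j hj
    rw [coeff_polar, coeff_eq_zero_of_natDegree_lt (n := j + 1) (by omega)]
    rcases (Nat.succ_le_of_lt hj).eq_or_lt with rfl | hj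
    · simp
    · rw [coeff_eq_zero_of_natDegree_lt (n := j) (by omega)]
      simp
  · have h1 : P.coeff n = -P.leadingCoeff * P.roots.sum := by
      rw [← (IsAlgClosed.splits P).nextCoeff_eq_neg_sum_roots_mul_leadingCoeff,
        nextCoeff_of_natDegree_pos (by omega), hd, Nat.add_sub_cancel]
    have h2 : P.coeff (n + 1) = P.leadingCoeff := by rw [leadingCoeff, hd]
    have h3 : P.roots.sum.im ≤ 0 := by
      rw [← Complex.coe_imAddGroupHom, map_multiset_sum]
      refine (Multiset.sum_le_card_nsmul _ 0 ?_).trans (by simp)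
      intro x hx
      obtain ⟨ρ, hρ, rfl⟩ := Multiset.mem_map.1 hx
      exact hP.im_le_zero hρ
    rw [coeff_polar, h1, h2]
    have h4 : v * (-P.leadingCoeff * P.roots.sum) * ((n + 1 - n) / (n + 1)) +
        u * P.leadingCoeff * ((n + 1) / (n + 1)) =
        P.leadingCoeff * (u - (v / (n + 1) : ℝ) * P.roots.sum) := by
      push_cast
      field_simp
      ring
    rw [h4]
    refine mul_ne_zero hlc fun h => ?_
    have h5 := congrArg Complex.im h
    rw [Complex.sub_im, Complex.im_ofReal_mul, Complex.zero_im] at h5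
    have : 0 ≤ v / (n + 1) := by positivity
    nlinarith

/-- Half-plane version of Grace's theorem. -/
theorem Stable.pairing_ne_zero {d : ℕ} {s : Multiset (ℂ × ℝ)}
    (hs : ∀ w ∈ s, 0 < w.1.im ∧ 0 ≤ w.2) (hc : s.card = d) {P : ℂ[X]} (hP : Stable P)
    (hd : P.natDegree = d) : pairing d (s.map fun w => C (w.2 : ℂ) + C w.1 * X).prod P ≠ 0 := by
  subst hc
  induction s using Multiset.induction generalizing P with
  | empty =>
    rw [Multiset.card_zero] at hd
    have h := hP Complex.I (by simp)
    rw [eq_C_of_natDegree_eq_zero hd, eval_C] at h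
    simpa [pairing_apply] using h
  | cons w s ih =>
    obtain ⟨hu, hv⟩ := hs w (Multiset.mem_cons_self w s)
    rw [Multiset.card_cons] at hd ⊢
    have hdeg : (s.map fun w : ℂ × ℝ => C (w.2 : ℂ) + C w.1 * X).prod.natDegree ≤ s.card := by
      refine (natDegree_multiset_prod_le _).trans ?_
      rw [Multiset.map_map]
      refine (Multiset.sum_le_card_nsmul _ 1 ?_).trans (by simp)
      intro x hx
      obtain ⟨w, -, rfl⟩ := Multiset.mem_map.1 hx
      simp only [Function.comp]
      compute_degree
    rw [Multiset.map_cons, Multiset.prod_cons, pairing_succ _ _ _ _ _ hdeg]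
    exact ih (fun w h => hs w (Multiset.mem_cons_of_mem h)) (hP.polar hd hu hv)
      (hP.natDegree_polar hd hu hv)

/-! ### Real-rootedness and root counting from the upper half-plane -/

/-- Zeros of a real polynomial are symmetric under conjugation, so the lower half-plane is free of
them too. -/
theorem splits_of_stable {p : ℝ[X]} (h : ∀ z : ℂ, 0 < z.im → aeval z p ≠ 0) : p.Splits := by
  refine Splits.of_splits_map (algebraMap ℝ ℂ) (IsAlgClosed.splits _) fun z hz => ?_
  have h0 : aeval z p = 0 := by
    rw [aeval_def, eval₂_eq_eval_map]; exact isRoot_of_mem_roots hz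
  rcases lt_trichotomy z.im 0 with h1 | h1 | h1
  · refine absurd ?_ (h ((starRingEnd ℂ) z) (by simpa using h1))
    rw [aeval_conj, h0, map_zero]
  · exact ⟨z.re, Complex.ext (by simp) (by simp [h1])⟩
  · exact absurd h0 (h z h1)

/-- The sum of the arguments of `z - x`, for `x` in the multiset `s`. -/
noncomputable def argSum (s : Multiset ℝ) (z : ℂ) : ℝ :=
  (s.map fun x : ℝ => (z - x).arg).sum

/-- `argSum` is a lift of the argument of the product to ℝ, not reduced modulo 2π; this is what lets
it count roots. -/
theorem prod_sub_eq_norm_mul_exp (s : Multiset ℝ) (z : ℂ) :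
    (s.map fun x : ℝ => z - (x : ℂ)).prod =
      ‖(s.map fun x : ℝ => z - (x : ℂ)).prod‖ * Complex.exp (argSum s z * Complex.I) := by
  induction s using Multiset.induction with
  | empty => simp [argSum]
  | cons x s ih =>
    have h1 := (Complex.norm_mul_exp_arg_mul_I (z - x)).symm
    simp only [argSum, Multiset.map_cons, Multiset.prod_cons, Multiset.sum_cons, norm_mul] at ih ⊢
    push_cast at ih ⊢
    rw [add_mul, Complex.exp_add]
    linear_combination (Multiset.map (fun x : ℝ => z - (x : ℂ)) s).prod * h1 +
      ‖z - x‖ * Complex.exp ((z - x).arg * Complex.I) * ih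

theorem continuousOn_argSum (s : Multiset ℝ) : ContinuousOn (argSum s) {z | 0 < z.im} := by
  intro z hz
  refine tendsto_multiset_sum s fun x _ => ?_
  have h1 : z - x ∈ Complex.slitPlane := by
    refine Or.inr ?_
    simpa using (ne_of_gt hz)
  have h2 : ContinuousAt (fun w : ℂ => (w - x).arg) z :=
    (Complex.continuousAt_arg h1).comp (f := fun w : ℂ => w - x) (by fun_prop)
  exact h2.tendsto.mono_left nhdsWithin_le_nhds

theorem tendsto_argSum_atTop (s : Multiset ℝ) :
    Tendsto (fun t : ℝ => argSum s (t * Complex.I)) atTop (𝓝 (s.card * (Real.pi / 2))) := by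
  have h : (s.card * (Real.pi / 2) : ℝ) = (s.map fun _ => Real.pi / 2).sum := by simp
  rw [h]
  refine tendsto_multiset_sum s fun x _ => ?_
  have h1 : Tendsto (fun t : ℝ => Complex.I - (x / t : ℝ)) atTop (𝓝 (Complex.I - (0 : ℝ))) :=
    tendsto_const_nhds.sub ((Complex.continuous_ofReal.tendsto _).comp
      (tendsto_const_nhds.div_atTop tendsto_id))
  have h2 := (Complex.continuousAt_arg (x := Complex.I - (0 : ℝ))
    (Or.inr (by simp))).tendsto.comp h1
  simp only [Complex.ofReal_zero, sub_zero, Complex.arg_I] at h2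
  refine h2.congr' ?_
  filter_upwards [eventually_gt_atTop 0] with t ht
  rw [Function.comp, ← Complex.arg_real_mul _ ht]
  congr 1
  have : (t : ℂ) ≠ 0 := by exact_mod_cast ht.ne'
  push_cast
  field_simp

/-- A root to the right of x contributes π, since the negative axis is approached from above where
the principal argument is continuous; a root to the left contributes 0. -/
theorem tendsto_argSum_nhdsGT (s : Multiset ℝ) {x : ℝ} (hx : x ∉ s) :
    Tendsto (fun t : ℝ => argSum s (x + t * Complex.I)) (𝓝[>] 0)
      (𝓝 (s.countP (x < ·) * Real.pi)) := by
  have h : (s.countP (x < ·) * Real.pi : ℝ) = (s.map fun y => if x < y then Real.pi else 0).sum := by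
    clear hx
    induction s using Multiset.induction with
    | empty => simp
    | cons a s ih =>
      rw [Multiset.map_cons, Multiset.sum_cons, ← ih, Multiset.countP_cons]
      split_ifs <;> push_cast <;> ring
  rw [h]
  refine tendsto_multiset_sum s fun y hy => ?_
  have h1 : Tendsto (fun t : ℝ => (x + t * Complex.I - y : ℂ)) (𝓝[>] 0) (𝓝 (x - y : ℝ)) := by
    have : Continuous (fun t : ℝ => (x + t * Complex.I - y : ℂ)) := by fun_prop
    simpa using (this.tendsto 0).mono_left nhdsWithin_le_nhds
  split_ifs with hxy
  · refine (Complex.tendsto_arg_nhdsWithin_im_nonneg_of_re_neg_of_im_zero (z := (x - y : ℝ))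
      (by simpa using hxy) (by simp)).comp (tendsto_nhdsWithin_iff.2 ⟨h1, ?_⟩)
    filter_upwards [self_mem_nhdsWithin] with t ht
    simpa using (le_of_lt ht)
  · have hlt : y < x := lt_of_le_of_ne (not_lt.1 hxy) fun h => hx (h ▸ hy)
    have h2 := (Complex.continuousAt_arg (x := ((x - y : ℝ) : ℂ))
      (Or.inl (by simpa using hlt))).tendsto.comp h1
    rwa [Complex.arg_ofReal_of_nonneg (by linarith)] at h2

/-- The difference of the two sums tends to 0 at i∞. Were it positive somewhere, connectedness of
the half-plane would produce a value in (0, π), where the sine, hence the imaginary part in `h`, is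
positive. -/
theorem argSum_le_argSum {s t : Multiset ℝ} (hc : s.card = t.card)
    (h : ∀ z : ℂ, 0 < z.im → ((s.map fun x : ℝ => z - (x : ℂ)).prod *
      (starRingEnd ℂ) (t.map fun x : ℝ => z - (x : ℂ)).prod).im ≤ 0) {z : ℂ} (hz : 0 < z.im) :
    argSum s z ≤ argSum t z := by
  by_contra! hlt
  have hlim : Tendsto (fun y : ℝ => argSum s (y * Complex.I) - argSum t (y * Complex.I)) atTop
      (𝓝 0) := by
    have := (tendsto_argSum_atTop s).sub (tendsto_argSum_atTop t)
    rwa [hc, sub_self] at this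
  set c := min (argSum s z - argSum t z) Real.pi / 2 with hcdef
  have hm : 0 < min (argSum s z - argSum t z) Real.pi := lt_min (by linarith) Real.pi_pos
  have hc0 : 0 < c := by positivity
  have hc1 : c < argSum s z - argSum t z := by
    have := min_le_left (argSum s z - argSum t z) Real.pi
    linarith
  have hc2 : c < Real.pi := by
    have := min_le_right (argSum s z - argSum t z) Real.pi
    linarith
  obtain ⟨y, hy, hy0⟩ := ((hlim.eventually (gt_mem_nhds hc0)).and (eventually_gt_atTop 0)).exists
  obtain ⟨w, hw, hwc⟩ := (convex_halfSpace_im_gt 0).isPreconnected.intermediate_value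
    (a := (y * Complex.I : ℂ)) (b := z) (by simpa using hy0) hz
    ((continuousOn_argSum s).sub (continuousOn_argSum t)) ⟨hy.le, hc1.le⟩
  have hne : ∀ u : Multiset ℝ, 0 < ‖(u.map fun x : ℝ => w - (x : ℂ)).prod‖ := by
    intro u
    rw [norm_pos_iff]
    refine Multiset.prod_ne_zero fun h0 => ?_
    obtain ⟨x, -, hx⟩ := Multiset.mem_map.1 h0
    have := congrArg Complex.im hx
    simp only [Complex.sub_im, Complex.ofReal_im, Complex.zero_im] at this
    have hw' : 0 < w.im := hw
    linarith
  have h1 := h w hw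
  rw [prod_sub_eq_norm_mul_exp s, prod_sub_eq_norm_mul_exp t, map_mul, Complex.conj_ofReal,
    ← Complex.exp_conj, map_mul, Complex.conj_ofReal, Complex.conj_I, mul_mul_mul_comm,
    ← Complex.exp_add, ← Complex.ofReal_mul, Complex.im_ofReal_mul] at h1
  have h2 : (argSum s w * Complex.I + argSum t w * -Complex.I : ℂ) = (c : ℝ) * Complex.I := by
    rw [← hwc, Pi.sub_apply]; push_cast; ring
  rw [h2, Complex.exp_ofReal_mul_I_im] at h1
  have := mul_pos (mul_pos (hne s) (hne t)) (Real.sin_pos_of_pos_of_lt_pi hc0 hc2)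
  linarith

/-- If the argument of `f / g` is in the lower half-plane on the upper half-plane, then `g` has at
least as many roots as `f` to the right of any point. -/
theorem countP_le_countP {s t : Multiset ℝ} (hc : s.card = t.card)
    (h : ∀ z : ℂ, 0 < z.im → ((s.map fun x : ℝ => z - (x : ℂ)).prod *
      (starRingEnd ℂ) (t.map fun x : ℝ => z - (x : ℂ)).prod).im ≤ 0) {x : ℝ} (hs : x ∉ s)
    (ht : x ∉ t) : s.countP (x < ·) ≤ t.countP (x < ·) := by
  have h1 := le_of_tendsto_of_tendsto (tendsto_argSum_nhdsGT s hs) (tendsto_argSum_nhdsGT t ht)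
    (by
      filter_upwards [self_mem_nhdsWithin] with y hy
      exact argSum_le_argSum hc h (by simpa using hy))
  exact_mod_cast le_of_mul_le_mul_right h1 Real.pi_pos

/-! ### Ordered roots and root counts -/

theorem lt_getD_iff_lt_countP {l : List ℝ} (hl : l.Pairwise (· ≥ ·)) (x : ℝ) {i : ℕ}
    (hi : i < l.length) : x < l.getD i 0 ↔ i < l.countP (x < ·) := by
  induction l generalizing i with
  | nil => simp at hi
  | cons a l ih =>
    rw [List.pairwise_cons] at hl
    rw [List.countP_cons]
    rcases lt_or_ge x a with hxa | hxa
    · rcases i with _ | i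
      · simp [hxa]
      · simpa [hxa] using ih hl.2 (by simpa using hi)
    · have h0 : l.countP (x < ·) = 0 := by
        rw [List.countP_eq_zero]
        intro b hb
        have := hl.1 b hb
        simp only [decide_eq_true_eq, not_lt]
        linarith
      rcases i with _ | i
      · simp [hxa.not_gt, h0]
      · have := ih hl.2 (by simpa using hi)
        simp only [h0] at this
        simpa [hxa.not_gt, h0] using this

theorem lt_orderedRoot_iff {p : ℝ[X]} (x : ℝ) {i : ℕ} (hi : i < p.roots.card) :
    x < orderedRoot p i ↔ i < p.roots.countP (x < ·) := by
  rw [orderedRoot, lt_getD_iff_lt_countP (p.roots.pairwise_sort _) x (by simpa using hi)]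
  conv_rhs => rw [← p.roots.sort_eq (· ≥ ·)]
  rw [Multiset.coe_countP]

theorem card_roots_of_mem_polys {d : ℕ} {K : Set ℝ} {p : ℝ[X]} (hp : p ∈ polys d K) :
    p.roots.card = d := by
  rw [← hp.2.1]; exact hp.2.2.1.natDegree_eq_card_roots.symm

/-- A violated inequality between ordered roots leaves an open interval of thresholds; being
infinite, it contains one that avoids all roots. -/
theorem rootLE_of_countP_le {d : ℕ} {p q : ℝ[X]} (hp : p ∈ polys d Set.univ)
    (hq : q ∈ polys d Set.univ)
    (h : ∀ x, x ∉ p.roots → x ∉ q.roots → p.roots.countP (x < ·) ≤ q.roots.countP (x < ·)) :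
    RootLE d p q := by
  refine ⟨hp, hq, fun i hi => ?_⟩
  by_contra! hlt
  obtain ⟨x, hx, hx'⟩ := ((Set.Ioo_infinite hlt).sdiff
    (p.roots.toFinset ∪ q.roots.toFinset).finite_toSet).nonempty
  simp only [Finset.coe_union, Set.mem_union, Finset.mem_coe, Multiset.mem_toFinset, not_or] at hx'
  have h1 := (lt_orderedRoot_iff x (by rwa [card_roots_of_mem_polys hp])).1 hx.2
  have h2 := (lt_orderedRoot_iff x (by rwa [card_roots_of_mem_polys hq])).2
    (h1.trans_le (h x hx'.1 hx'.2))
  exact absurd h2 hx.1.not_gt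

theorem aeval_eq_prod_of_mem_polys {d : ℕ} {K : Set ℝ} {p : ℝ[X]} (hp : p ∈ polys d K) (z : ℂ) :
    aeval z p = (p.roots.map fun x : ℝ => z - (x : ℂ)).prod := by
  conv_lhs => rw [hp.2.2.1.eq_prod_roots_of_monic hp.1]
  rw [map_multiset_prod, Multiset.map_map]
  simp

theorem rootLE_of_im_mul_conj_nonpos {d : ℕ} {p q : ℝ[X]} (hp : p ∈ polys d Set.univ)
    (hq : q ∈ polys d Set.univ)
    (h : ∀ z : ℂ, 0 < z.im → (aeval z p * (starRingEnd ℂ) (aeval z q)).im ≤ 0) :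
    RootLE d p q := by
  refine rootLE_of_countP_le hp hq fun x h1 h2 => countP_le_countP
    (by rw [card_roots_of_mem_polys hp, card_roots_of_mem_polys hq]) (fun z hz => ?_) h1 h2
  rw [← aeval_eq_prod_of_mem_polys hp, ← aeval_eq_prod_of_mem_polys hq]
  exact h z hz

theorem RootLE.trans {d : ℕ} {p q r : ℝ[X]} (h : RootLE d p q) (h' : RootLE d q r) :
    RootLE d p r :=
  ⟨h.1, h'.2.1, fun i hi => (h.2.2 i hi).trans (h'.2.2 i hi)⟩

/-! ### Operators preserving stability are monotone -/

/-- An operator from monic polynomials of degree `d` to monic polynomials of degree `m` which is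
given by complex linear functionals that do not vanish on stable polynomials. -/
structure PreservesStability (d m : ℕ) (T : ℝ[X] → ℝ[X]) : Prop where
  monic : ∀ p : ℝ[X], p.Monic → p.natDegree = d → (T p).Monic
  natDegree : ∀ p : ℝ[X], p.Monic → p.natDegree = d → (T p).natDegree = m
  exists_functional : ∀ z : ℂ, 0 < z.im → ∃ L : ℂ[X] →ₗ[ℂ] ℂ,
    (∀ p : ℝ[X], p.Monic → p.natDegree = d → aeval z (T p) = L (p.map (algebraMap ℝ ℂ))) ∧
    ∀ P : ℂ[X], Stable P → P.natDegree = d → L P ≠ 0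

theorem stable_X_sub_C_mul {P : ℂ[X]} (hP : Stable P) {c : ℂ} (hc : c.im ≤ 0) :
    Stable ((X - C c) * P) := by
  intro z hz
  rw [eval_mul, eval_sub, eval_X, eval_C]
  refine mul_ne_zero (fun h => ?_) (hP z hz)
  have := congrArg Complex.im h
  rw [Complex.sub_im, Complex.zero_im] at this
  linarith

theorem stable_map_prod (s : Multiset ℝ) :
    Stable ((s.map fun x => X - C x).prod.map (algebraMap ℝ ℂ)) := by
  induction s using Multiset.induction with
  | empty => intro z _; simp
  | cons x s ih =>
    rw [Multiset.map_cons, Multiset.prod_cons, Polynomial.map_mul, Polynomial.map_sub, map_X, map_C]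
    exact stable_X_sub_C_mul ih (by simp)

theorem monic_prod (s : Multiset ℝ) : (s.map fun x => X - C x).prod.Monic :=
  monic_multiset_prod_of_monic _ _ fun x _ => monic_X_sub_C x

theorem natDegree_prod (s : Multiset ℝ) : (s.map fun x => X - C x).prod.natDegree = s.card := by
  simp

namespace PreservesStability

theorem mem_polys {d m : ℕ} {T : ℝ[X] → ℝ[X]} (hT : PreservesStability d m T)
    {s : Multiset ℝ} (hs : s.card = d) :
    T (s.map fun x => X - C x).prod ∈ polys m Set.univ := by
  have h1 := monic_prod s
  have h2 := (natDegree_prod s).trans hs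
  refine ⟨hT.monic _ h1 h2, hT.natDegree _ h1 h2, splits_of_stable fun z hz => ?_,
    fun x _ => Set.mem_univ x⟩
  obtain ⟨L, hL, hL'⟩ := hT.exists_functional z hz
  rw [hL _ h1 h2]
  exact hL' _ (stable_map_prod s) (by rw [h1.natDegree_map, h2])

theorem rootLE_cons {d m : ℕ} {T : ℝ[X] → ℝ[X]} (hT : PreservesStability d m T)
    {s : Multiset ℝ} {a b : ℝ} (hab : a ≤ b) (hs : s.card + 1 = d) :
    RootLE m (T ((a ::ₘ s).map fun x => X - C x).prod) (T ((b ::ₘ s).map fun x => X - C x).prod) := by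
  have hc : ∀ c : ℝ, (c ::ₘ s).card = d := fun c => by rw [Multiset.card_cons, hs]
  refine rootLE_of_im_mul_conj_nonpos (hT.mem_polys (hc a)) (hT.mem_polys (hc b)) fun z hz => ?_
  obtain ⟨L, hL, hL'⟩ := hT.exists_functional z hz
  set S := (s.map fun x => X - C x).prod.map (algebraMap ℝ ℂ) with hS
  have hSm : S.Monic := (monic_prod s).map _
  have hSd : S.natDegree + 1 = d := by rw [hS, (monic_prod s).natDegree_map, natDegree_prod, hs]
  have heval : ∀ c : ℝ, aeval z (T ((c ::ₘ s).map fun x => X - C x).prod) =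
      L (X * S) - c * L S := by
    intro c
    rw [hL _ (monic_prod _) ((natDegree_prod _).trans (hc c)), Multiset.map_cons,
      Multiset.prod_cons, Polynomial.map_mul, Polynomial.map_sub, map_X, map_C, ← hS, sub_mul,
      map_sub, ← smul_eq_C_mul, map_smul, smul_eq_mul]
    rfl
  -- Non-real c are essential: excluding F = cG on the whole closed lower half-plane is what places
  -- F/G in the upper one.
  have hne : ∀ c : ℂ, c.im ≤ 0 → L (X * S) ≠ c * L S := by
    intro c hc h
    refine hL' ((X - C c) * S) (stable_X_sub_C_mul (stable_map_prod s) hc) ?_ ?_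
    · rw [(monic_X_sub_C c).natDegree_mul hSm, natDegree_X_sub_C, add_comm, hSd]
    · rw [sub_mul, map_sub, ← smul_eq_C_mul, map_smul, smul_eq_mul, h, sub_self]
  rw [heval, heval]
  generalize L (X * S) = F at *
  generalize L S = G at *
  have hFG : 0 ≤ (F * (starRingEnd ℂ) G).im := by
    rcases eq_or_ne G 0 with rfl | hG
    · simp
    · by_contra! hlt
      refine hne (F / G) ?_ (by field_simp)
      have h1 : F / G = ((Complex.normSq G)⁻¹ : ℝ) * (F * (starRingEnd ℂ) G) := by
        rw [div_eq_mul_inv, Complex.inv_def]; ring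
      rw [h1, Complex.im_ofReal_mul]
      exact mul_nonpos_of_nonneg_of_nonpos (inv_nonneg.2 (Complex.normSq_nonneg G)) hlt.le
  simp only [Complex.mul_im, Complex.sub_re, Complex.sub_im, Complex.conj_re, Complex.conj_im,
    map_sub, map_mul, Complex.conj_ofReal, Complex.ofReal_re, Complex.ofReal_im,
    Complex.mul_re] at hFG ⊢
  nlinarith [mul_nonneg (sub_nonneg.2 hab) hFG]

/-- Roots are raised one at a time; `s` collects those already moved. -/
theorem rootLE_of_forall₂ {d m : ℕ} {T : ℝ[X] → ℝ[X]} (hT : PreservesStability d m T)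
    {l l' : List ℝ} (h : List.Forall₂ (· ≤ ·) l l') (s : Multiset ℝ)
    (hs : s.card + l.length = d) :
    RootLE m (T ((s + l).map fun x => X - C x).prod) (T ((s + l').map fun x => X - C x).prod) := by
  induction h generalizing s with
  | nil =>
    have := hT.mem_polys (s := s) (by simpa using hs)
    simpa using ⟨this, this, fun _ _ => le_rfl⟩
  | @cons a b l l' hab hl ih =>
    have h1 := hT.rootLE_cons hab (s := s + l) (by simpa [add_assoc] using hs)
    have h2 := ih (b ::ₘ s) (by simp at hs ⊢; omega)
    rw [Multiset.cons_add] at h2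
    rw [← Multiset.cons_coe, ← Multiset.cons_coe, Multiset.add_cons, Multiset.add_cons]
    rw [Multiset.cons_add] at h2
    exact h1.trans h2

theorem rootLE {d m : ℕ} {T : ℝ[X] → ℝ[X]} (hT : PreservesStability d m T)
    {p q : ℝ[X]} (h : RootLE d p q) : RootLE m (T p) (T q) := by
  obtain ⟨hp, hq, hle⟩ := h
  have cp := card_roots_of_mem_polys hp
  have cq := card_roots_of_mem_polys hq
  have h1 : List.Forall₂ (· ≤ ·) (p.roots.sort (· ≥ ·)) (q.roots.sort (· ≥ ·)) := by
    rw [List.forall₂_iff_get]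
    refine ⟨by simp [cp, cq], fun i hi hi' => ?_⟩
    have := hle i (by simpa [cp] using hi)
    rw [orderedRoot, orderedRoot, List.getD_eq_getElem _ _ hi, List.getD_eq_getElem _ _ hi'] at this
    simpa using this
  have h2 := hT.rootLE_of_forall₂ h1 0 (by simp [cp])
  rw [zero_add, zero_add, Multiset.sort_eq, Multiset.sort_eq,
    ← hp.2.2.1.eq_prod_roots_of_monic hp.1, ← hq.2.2.1.eq_prod_roots_of_monic hq.1] at h2
  exact h2

end PreservesStability

/-! ### The convolutions and the derivative as stability-preserving operators -/

theorem coeff_ofNormCoeff {d : ℕ} (a : ℕ → ℝ) {k : ℕ} (hk : k ≤ d) :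
    (ofNormCoeff d a).coeff (d - k) = (-1) ^ k * (d.choose k : ℝ) * a k := by
  rw [ofNormCoeff, finsetSum_coeff, Finset.sum_eq_single k]
  · simp
  · intro j hj hjk
    rw [Finset.mem_range] at hj
    rw [coeff_monomial, if_neg (by omega)]
  · intro h
    simp at h
    omega

theorem natDegree_ofNormCoeff_le (d : ℕ) (a : ℕ → ℝ) : (ofNormCoeff d a).natDegree ≤ d :=
  natDegree_sum_le_of_forall_le _ _ fun _ _ => (natDegree_monomial_le _).trans (Nat.sub_le _ _)

theorem coeff_ofNormCoeff_self (d : ℕ) (a : ℕ → ℝ) : (ofNormCoeff d a).coeff d = a 0 := by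
  simpa using coeff_ofNormCoeff a (Nat.zero_le d)

theorem monic_ofNormCoeff {d : ℕ} {a : ℕ → ℝ} (ha : a 0 = 1) : (ofNormCoeff d a).Monic :=
  monic_of_natDegree_le_of_coeff_eq_one d (natDegree_ofNormCoeff_le d a)
    ((coeff_ofNormCoeff_self d a).trans ha)

theorem natDegree_ofNormCoeff {d : ℕ} {a : ℕ → ℝ} (ha : a 0 = 1) :
    (ofNormCoeff d a).natDegree = d :=
  natDegree_eq_of_le_of_coeff_ne_zero (natDegree_ofNormCoeff_le d a)
    (by rw [coeff_ofNormCoeff_self, ha]; exact one_ne_zero)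

theorem normCoeff_zero {d : ℕ} {p : ℝ[X]} (hp : p.Monic) (hd : p.natDegree = d) :
    normCoeff d p 0 = 1 := by
  simp only [normCoeff, pow_zero, Nat.sub_zero, one_mul, Nat.choose_zero_right, Nat.cast_one,
    div_one]
  rw [← hd]
  exact hp

theorem coeff_eq_normCoeff {d : ℕ} (p : ℝ[X]) {k : ℕ} (hk : k ≤ d) :
    p.coeff (d - k) = (-1) ^ k * (d.choose k : ℝ) * normCoeff d p k := by
  have hc : (d.choose k : ℝ) ≠ 0 := by exact_mod_cast (Nat.choose_pos hk).ne'
  have h1 : ((-1 : ℝ) ^ k) * (-1) ^ k = 1 := by rw [← mul_pow]; norm_num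
  rw [normCoeff]
  field_simp
  linear_combination (-p.coeff (d - k)) * h1

/-- Makes p ⊞ r a differential operator, with coefficients from `p`, applied to `r`; its value at z
is then a pairing of `p` with the Taylor coefficients of `r` at z. The binomials match by C(d,k)
C(k,j) = C(d,k-j) C(d-k+j,j). -/
theorem addConv_eq_sum_hasseDeriv {d : ℕ} (p : ℝ[X]) {r : ℝ[X]} (hr : r.natDegree ≤ d) :
    addConv d p r =
      ∑ j ∈ Finset.range (d + 1), ((-1) ^ j * normCoeff d p j) • hasseDeriv j r := by
  ext n
  rw [finsetSum_coeff]
  rcases lt_or_ge d n with hn | hn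
  · rw [addConv, coeff_eq_zero_of_natDegree_lt ((natDegree_ofNormCoeff_le d _).trans_lt hn)]
    symm
    refine Finset.sum_eq_zero fun j _ => ?_
    rw [coeff_smul, hasseDeriv_coeff, coeff_eq_zero_of_natDegree_lt (by omega)]
    simp
  obtain ⟨k, hk, rfl⟩ : ∃ k ≤ d, n = d - k := ⟨d - n, by omega, by omega⟩
  rw [addConv, coeff_ofNormCoeff _ hk, Finset.mul_sum]
  have hsub : Finset.range (k + 1) ⊆ Finset.range (d + 1) := by
    rw [Finset.range_subset_range]; omega
  rw [← Finset.sum_subset hsub]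
  · refine Finset.sum_congr rfl fun j hj => ?_
    rw [Finset.mem_range] at hj
    have h1 : d - k + j = d - (k - j) := by omega
    have h2 : (d.choose k : ℝ) * k.choose j =
        d.choose (k - j) * ((d - (k - j)).choose j : ℝ) := by
      have := Nat.choose_mul (n := d) (k := k) (s := k - j) (Nat.sub_le _ _)
      rw [Nat.choose_symm (by omega), show k - (k - j) = j by omega] at this
      exact_mod_cast this
    have h3 : (-1 : ℝ) ^ k = (-1) ^ j * (-1) ^ (k - j) := by
      rw [← pow_add]; congr 1; omega
    rw [coeff_smul, smul_eq_mul, hasseDeriv_coeff, h1, coeff_eq_normCoeff r (by omega), h3]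
    linear_combination (-1) ^ j * (-1) ^ (k - j) * normCoeff d p j * normCoeff d r (k - j) * h2
  · intro j _ hj
    rw [Finset.mem_range] at hj
    rw [coeff_smul, hasseDeriv_coeff, coeff_eq_zero_of_natDegree_lt (by omega)]
    simp

theorem reverse_prod_X_add_C (s : Multiset ℂ) :
    (s.map fun w => X + C w).prod.reverse = (s.map fun w => C 1 + C w * X).prod := by
  induction s using Multiset.induction with
  | empty => simp [← C_1, -map_one]
  | cons w s ih =>
    have h1 : (X + C w : ℂ[X]).reverse = C 1 + C w * X := by
      have h2 : (X : ℂ[X]).reverse = 1 := by rw [reverse, natDegree_X, reflect_one_X]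
      rw [reverse_add_C, h2, natDegree_X, pow_one, C_1]
    rw [Multiset.map_cons, Multiset.prod_cons, Multiset.map_cons, Multiset.prod_cons,
      reverse_mul_of_domain, ih, h1]

/-- The pairing is with ∏ (1 + (z - x) X) over the roots x of `r`, the reversed Taylor expansion of
`r` at z; each z - x has positive imaginary part. -/
theorem preservesStability_addConv {d : ℕ} {r : ℝ[X]} (hr : r ∈ polys d Set.univ) :
    PreservesStability d d (fun p => addConv d p r) where
  monic p hp hd := by
    refine monic_ofNormCoeff (d := d) ?_
    simp [normCoeff_zero hp hd, normCoeff_zero hr.1 hr.2.1]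
  natDegree p hp hd := by
    refine natDegree_ofNormCoeff (d := d) ?_
    simp [normCoeff_zero hp hd, normCoeff_zero hr.1 hr.2.1]
  exists_functional z hz := by
    obtain ⟨s, hs⟩ : ∃ s : Multiset (ℂ × ℝ), s = r.roots.map fun x : ℝ => (z - x, 1) := ⟨_, rfl⟩
    have hcard : s.card = d := by rw [hs, Multiset.card_map, card_roots_of_mem_polys hr]
    refine ⟨pairing d (s.map fun w => C (w.2 : ℂ) + C w.1 * X).prod, fun p _ _ => ?_,
      fun P hP hd => ?_⟩
    · have hQ : (s.map fun w => C (w.2 : ℂ) + C w.1 * X).prod =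
          (taylor z (r.map (algebraMap ℝ ℂ))).reverse := by
        have h1 : taylor z (r.map (algebraMap ℝ ℂ)) =
            ((r.roots.map fun x : ℝ => (z - x : ℂ)).map fun w => X + C w).prod := by
          conv_lhs => rw [hr.2.2.1.eq_prod_roots_of_monic hr.1]
          rw [Polynomial.map_multiset_prod, Multiset.map_map, taylor_apply, multiset_prod_comp,
            Multiset.map_map, Multiset.map_map]
          congr 1
          refine Multiset.map_congr rfl fun x _ => ?_
          simp
          ring
        rw [h1, reverse_prod_X_add_C, hs, Multiset.map_map, Multiset.map_map]
        simp
      have htd : (taylor z (r.map (algebraMap ℝ ℂ))).natDegree = d := by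
        rw [natDegree_taylor, hr.1.natDegree_map, hr.2.1]
      rw [hQ, pairing_apply, addConv_eq_sum_hasseDeriv p hr.2.1.le, map_sum,
        ← Finset.sum_range_reflect]
      refine Finset.sum_congr rfl fun j hj => ?_
      have hj' : j ≤ d := by rw [Finset.mem_range] at hj; omega
      have hm : (hasseDeriv (d - j) r).map (algebraMap ℝ ℂ) =
          hasseDeriv (d - j) (r.map (algebraMap ℝ ℂ)) := by
        ext n; simp [hasseDeriv_coeff]
      have hc : (d.choose j : ℂ) ≠ 0 := by exact_mod_cast (Nat.choose_pos hj').ne'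
      rw [coeff_reverse, htd, revAt_le hj', taylor_coeff, ← hm, eval_map_algebraMap,
        Nat.add_sub_cancel, map_smul, coeff_map]
      conv_rhs => rw [show j = d - (d - j) by omega, coeff_eq_normCoeff p (Nat.sub_le d j),
        show d - (d - j) = j by omega, Nat.choose_symm hj']
      rw [Complex.real_smul]
      push_cast
      simp only [Complex.coe_algebraMap]
      field_simp
    · refine hP.pairing_ne_zero (fun w hw => ?_) hcard hd
      rw [hs] at hw
      obtain ⟨x, -, rfl⟩ := Multiset.mem_map.1 hw
      simpa using hz

/-- The pairing is with ∏ (x + z X) over the roots x of `r`; Grace's theorem needs x ≥ 0 here. -/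
theorem preservesStability_mulConv {d : ℕ} {r : ℝ[X]} (hr : r ∈ polys d (Set.Ici 0)) :
    PreservesStability d d (fun p => mulConv d p r) where
  monic p hp hd := by
    refine monic_ofNormCoeff (d := d) ?_
    simp [normCoeff_zero hp hd, normCoeff_zero hr.1 hr.2.1]
  natDegree p hp hd := by
    refine natDegree_ofNormCoeff (d := d) ?_
    simp [normCoeff_zero hp hd, normCoeff_zero hr.1 hr.2.1]
  exists_functional z hz := by
    obtain ⟨s, hs⟩ : ∃ s : Multiset (ℂ × ℝ), s = r.roots.map fun x : ℝ => (z, x) := ⟨_, rfl⟩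
    have hcard : s.card = d := by rw [hs, Multiset.card_map, card_roots_of_mem_polys hr]
    refine ⟨pairing d (s.map fun w => C (w.2 : ℂ) + C w.1 * X).prod, fun p _ _ => ?_,
      fun P hP hd => ?_⟩
    · have hQ : (s.map fun w => C (w.2 : ℂ) + C w.1 * X).prod =
          ((r.roots.map fun x => X + C x).prod.map (algebraMap ℝ ℂ)).comp (C z * X) := by
        rw [Polynomial.map_multiset_prod, Multiset.map_map, multiset_prod_comp,
          Multiset.map_map, hs, Multiset.map_map]
        congr 1
        refine Multiset.map_congr rfl fun x _ => ?_
        simp [add_comm]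
      rw [hQ, pairing_apply, mulConv, ofNormCoeff, map_sum]
      conv_rhs => rw [← Finset.sum_range_reflect]
      refine Finset.sum_congr rfl fun k hk => ?_
      have hk' : k ≤ d := by rw [Finset.mem_range] at hk; omega
      have hc : (d.choose k : ℂ) ≠ 0 := by exact_mod_cast (Nat.choose_pos hk').ne'
      have hcr := card_roots_of_mem_polys hr
      rw [Nat.add_sub_cancel, comp_C_mul_X_coeff, coeff_map, coeff_map, coeff_eq_normCoeff p hk',
        Nat.choose_symm hk', r.roots.prod_X_add_C_coeff (by omega), hcr, aeval_monomial,
        show d - (d - k) = k by omega,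
        normCoeff_eq_esymm ⟨hr.1, hr.2.1, hr.2.2.1, fun x _ => Set.mem_univ x⟩ hk']
      simp only [map_mul, map_div₀, map_pow, map_neg, map_one, map_natCast, Complex.coe_algebraMap]
      field_simp
    · refine hP.pairing_ne_zero (fun w hw => ?_) hcard hd
      rw [hs] at hw
      obtain ⟨x, hx, rfl⟩ := Multiset.mem_map.1 hw
      exact ⟨hz, hr.2.2.2 x (isRoot_of_mem_roots hx)⟩

/-- Up to a nonzero constant, the derivative is the polar derivative with pole at infinity (v = 0).
-/
theorem Stable.derivative {n : ℕ} {P : ℂ[X]} (hP : Stable P) (hd : P.natDegree = n + 1) :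
    Stable (derivative P) ∧ (Polynomial.derivative P).natDegree = n := by
  have hn : (n + 1 : ℂ) ≠ 0 := by exact_mod_cast n.succ_ne_zero
  have h : FiniteFree.polar n Complex.I (0 : ℝ) P =
      C (Complex.I / (n + 1)) * Polynomial.derivative P := by
    simp [FiniteFree.polar]
  have h1 := hP.polar hd (u := Complex.I) (v := 0) (by simp) le_rfl
  have h2 := hP.natDegree_polar hd (u := Complex.I) (v := 0) (by simp) le_rfl
  rw [h] at h1 h2
  refine ⟨fun z hz h0 => h1 z hz (by rw [eval_mul, h0, mul_zero]), ?_⟩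
  rwa [natDegree_C_mul (div_ne_zero Complex.I_ne_zero hn)] at h2

theorem Stable.iterate_derivative {P : ℂ[X]} (hP : Stable P) {k n : ℕ}
    (hd : P.natDegree = n + k) : Stable (Polynomial.derivative^[k] P) := by
  induction k generalizing P with
  | zero => exact hP
  | succ k ih =>
    obtain ⟨h1, h2⟩ := hP.derivative (n := n + k) hd
    exact ih h1 h2

theorem preservesStability_normDeriv {d k : ℕ} (hk : k ≤ d) :
    PreservesStability d k (normDeriv d k) := by
  have hf : ((d.descFactorial (d - k) : ℕ) : ℝ) ≠ 0 := by
    exact_mod_cast (Nat.descFactorial_pos.2 (Nat.sub_le d k)).ne'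
  have hle : ∀ p : ℝ[X], p.natDegree = d → (normDeriv d k p).natDegree ≤ k := fun p hd =>
    (natDegree_C_mul_le _ _).trans
      ((natDegree_iterate_derivative p (d - k)).trans (by omega))
  have hcoeff : ∀ p : ℝ[X], p.Monic → p.natDegree = d → (normDeriv d k p).coeff k = 1 := by
    intro p hp hd
    have h1 : p.coeff d = 1 := by rw [← hd]; exact hp
    rw [normDeriv, coeff_C_mul, coeff_iterate_derivative, Nat.add_sub_cancel' hk, h1,
      nsmul_eq_mul, mul_one, inv_mul_cancel₀ hf]
  refine ⟨fun p hp hd => monic_of_natDegree_le_of_coeff_eq_one k (hle p hd) (hcoeff p hp hd),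
    fun p hp hd => natDegree_eq_of_le_of_coeff_ne_zero (hle p hd)
      (by rw [hcoeff p hp hd]; exact one_ne_zero), fun z hz => ?_⟩
  refine ⟨((d.descFactorial (d - k) : ℂ)⁻¹) •
    (leval z ∘ₗ (Polynomial.derivative ^ (d - k) : Module.End ℂ ℂ[X])), fun p _ _ => ?_,
    fun P hP hd => ?_⟩
  · rw [LinearMap.smul_apply, LinearMap.comp_apply, Module.End.pow_apply, leval_apply,
      iterate_derivative_map, eval_map_algebraMap, normDeriv, map_mul, aeval_C]
    simp
  · rw [LinearMap.smul_apply, LinearMap.comp_apply, Module.End.pow_apply, leval_apply, smul_eq_mul]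
    exact mul_ne_zero (inv_ne_zero (by exact_mod_cast hf))
      (hP.iterate_derivative (n := k) (by omega) z hz)

/-! ### Nonnegative roots and multiplicative powers -/

theorem polys_mono {d : ℕ} {K K' : Set ℝ} (h : K ⊆ K') : polys d K ⊆ polys d K' :=
  fun _ hp => ⟨hp.1, hp.2.1, hp.2.2.1, fun x hx => h (hp.2.2.2 x hx)⟩

theorem RootLE.refl {d : ℕ} {p : ℝ[X]} (hp : p ∈ polys d Set.univ) : RootLE d p p :=
  ⟨hp, hp, fun _ _ => le_rfl⟩

theorem mulConv_comm (d : ℕ) (p q : ℝ[X]) : mulConv d p q = mulConv d q p := by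
  simp only [mulConv, mul_comm]

theorem multiset_esymm_nonneg {s : Multiset ℝ} (h : ∀ x ∈ s, 0 ≤ x) (k : ℕ) : 0 ≤ s.esymm k := by
  refine Multiset.sum_nonneg fun y hy => ?_
  obtain ⟨t, ht, rfl⟩ := Multiset.mem_map.1 hy
  exact Multiset.prod_nonneg fun x hx =>
    h x (Multiset.mem_of_le (Multiset.mem_powersetCard.1 ht).1 hx)

theorem normCoeff_nonneg {d : ℕ} {p : ℝ[X]} (hp : p ∈ polys d (Set.Ici 0)) {k : ℕ} (hk : k ≤ d) :
    0 ≤ normCoeff d p k := by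
  rw [normCoeff_eq_esymm (polys_mono (Set.subset_univ _) hp) hk]
  exact div_nonneg
    (multiset_esymm_nonneg (fun x hx => hp.2.2.2 x (isRoot_of_mem_roots hx)) k) (Nat.cast_nonneg _)

/-- At x < 0 all terms of (-1)^d p(x) are nonnegative and the leading one is positive. -/
theorem mem_polys_Ici_of_normCoeff_nonneg {d : ℕ} {p : ℝ[X]} (hp : p ∈ polys d Set.univ)
    (h : ∀ k ≤ d, 0 ≤ normCoeff d p k) : p ∈ polys d (Set.Ici 0) := by
  refine ⟨hp.1, hp.2.1, hp.2.2.1, fun x hx => ?_⟩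
  by_contra hneg
  rw [Set.mem_Ici, not_le] at hneg
  have h1 : p.eval x = (-1) ^ d *
      ∑ k ∈ Finset.range (d + 1), d.choose k * normCoeff d p k * (-x) ^ (d - k) := by
    rw [eval_eq_sum_range, hp.2.1, ← Finset.sum_range_reflect, Finset.mul_sum]
    refine Finset.sum_congr rfl fun k hk => ?_
    have hk' : k ≤ d := by rw [Finset.mem_range] at hk; omega
    have h2 : (-1 : ℝ) ^ d = (-1) ^ k * (-1) ^ (d - k) := by
      rw [← pow_add, Nat.add_sub_cancel' hk']
    have h3 : ((-1 : ℝ) ^ (d - k)) * (-1) ^ (d - k) = 1 := by rw [← mul_pow]; norm_num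
    rw [Nat.add_sub_cancel, coeff_eq_normCoeff p hk', neg_pow x, h2]
    linear_combination (-((-1) ^ k * d.choose k * normCoeff d p k * x ^ (d - k))) * h3
  have h2 : 0 < ∑ k ∈ Finset.range (d + 1), d.choose k * normCoeff d p k * (-x) ^ (d - k) := by
    refine Finset.sum_pos' (fun k hk => ?_) ⟨0, by simp, ?_⟩
    · have := h k (by rw [Finset.mem_range] at hk; omega)
      have hx' : 0 < -x := by linarith
      positivity
    · rw [normCoeff_zero hp.1 hp.2.1]
      have hx' : 0 < -x := by linarith
      simp only [Nat.choose_zero_right, Nat.cast_one, one_mul]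
      positivity
  rw [IsRoot.def, h1] at hx
  exact (mul_ne_zero (pow_ne_zero _ (by norm_num)) h2.ne') hx

theorem mulConv_mem_polys_Ici {d : ℕ} {p q : ℝ[X]} (hp : p ∈ polys d (Set.Ici 0))
    (hq : q ∈ polys d (Set.Ici 0)) : mulConv d p q ∈ polys d (Set.Ici 0) := by
  refine mem_polys_Ici_of_normCoeff_nonneg ((preservesStability_mulConv hq).rootLE
    (RootLE.refl (polys_mono (Set.subset_univ _) hp))).1 fun k hk => ?_
  rw [mulConv, normCoeff_ofNormCoeff _ hk]
  exact mul_nonneg (normCoeff_nonneg hp hk) (normCoeff_nonneg hq hk)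

theorem X_sub_one_pow_mem_polys (d : ℕ) : ((X - 1) ^ d : ℝ[X]) ∈ polys d (Set.Ici 0) := by
  rw [← C_1]
  refine ⟨(monic_X_sub_C 1).pow d, by rw [natDegree_pow, natDegree_X_sub_C, mul_one],
    (Splits.X_sub_C 1).pow d, fun x hx => ?_⟩
  rw [IsRoot.def, eval_pow, eval_sub, eval_X, eval_C] at hx
  rw [sub_eq_zero.1 (eq_zero_of_pow_eq_zero hx)]
  exact Set.mem_Ici.2 zero_le_one

theorem mulConvPow_mem_polys {d : ℕ} {p : ℝ[X]} (hp : p ∈ polys d (Set.Ici 0)) (n : ℕ) :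
    mulConvPow d p n ∈ polys d (Set.Ici 0) := by
  induction n with
  | zero => exact X_sub_one_pow_mem_polys d
  | succ n ih => exact mulConv_mem_polys_Ici ih hp

theorem normCoeff_mulConvPow {d : ℕ} (p : ℝ[X]) (n : ℕ) {k : ℕ} (hk : k ≤ d) :
    normCoeff d (mulConvPow d p n) k = normCoeff d p k ^ n := by
  induction n with
  | zero =>
    have hc : (d.choose k : ℝ) ≠ 0 := by exact_mod_cast (Nat.choose_pos hk).ne'
    rw [mulConvPow, normCoeff, sub_eq_add_neg, ← C_1, ← C_neg, coeff_X_add_C_pow, Nat.choose_symm hk,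
      show d - (d - k) = k by omega, ← mul_assoc, ← mul_pow, mul_div_assoc, div_self hc]
    norm_num
  | succ n ih => rw [mulConvPow, mulConv, normCoeff_ofNormCoeff _ hk, ih, pow_succ]

/-- Inductive step, one factor at a time: pⁿ ⊠ p ≪ qⁿ ⊠ p ≪ qⁿ ⊠ q. -/
theorem RootLE.mulConvPow {d : ℕ} {p q : ℝ[X]} (h : RootLE d p q)
    (hp : p ∈ polys d (Set.Ici 0)) (hq : q ∈ polys d (Set.Ici 0)) (n : ℕ) :
    RootLE d (mulConvPow d p n) (mulConvPow d q n) := by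
  induction n with
  | zero => exact RootLE.refl (polys_mono (Set.subset_univ _) (X_sub_one_pow_mem_polys d))
  | succ n ih =>
    refine ((preservesStability_mulConv hp).rootLE ih).trans ?_
    rw [mulConv_comm d _ p, FiniteFree.mulConvPow, mulConv_comm d _ q]
    exact (preservesStability_mulConv (mulConvPow_mem_polys hq n)).rootLE h

/-! ### Products of the largest roots and the limit Φ -/

theorem multiset_esymm_cons (a : ℝ) (s : Multiset ℝ) (k : ℕ) :
    (a ::ₘ s).esymm (k + 1) = s.esymm (k + 1) + a * s.esymm k := by
  simp only [Multiset.esymm, Multiset.powersetCard_cons, Multiset.map_add, Multiset.sum_add,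
    Multiset.map_map, Function.comp_def, Multiset.prod_cons, Multiset.sum_map_mul_left]

theorem prod_getD_le_esymm {l : List ℝ} (h0 : ∀ x ∈ l, 0 ≤ x) {k : ℕ} (hk : k ≤ l.length) :
    ∏ i ∈ Finset.range k, l.getD i 0 ≤ (l : Multiset ℝ).esymm k := by
  induction l generalizing k with
  | nil =>
    obtain rfl : k = 0 := by simpa using hk
    simp [Multiset.esymm]
  | cons a l ih =>
    rcases k with _ | k
    · simp [Multiset.esymm]
    have h1 : ∀ x ∈ l, 0 ≤ x := fun x hx => h0 x (List.mem_cons_of_mem a hx)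
    rw [← Multiset.cons_coe, multiset_esymm_cons, Finset.prod_range_succ']
    simp only [List.getD_cons_succ, List.getD_cons_zero]
    have h2 := mul_le_mul_of_nonneg_left (ih h1 (k := k) (by simpa using hk))
      (h0 a List.mem_cons_self)
    have h3 := multiset_esymm_nonneg (s := (l : Multiset ℝ)) (by simpa using h1) (k + 1)
    linarith

theorem getD_nonneg {l : List ℝ} (h0 : ∀ x ∈ l, 0 ≤ x) (i : ℕ) : 0 ≤ l.getD i 0 := by
  rcases lt_or_ge i l.length with hi | hi
  · rw [List.getD_eq_getElem _ _ hi]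
    exact h0 _ (List.getElem_mem hi)
  · rw [List.getD_eq_default _ _ hi]

/-- Each of the `l.length.choose k` products in the symmetric function is at most the product of the
k largest entries. -/
theorem esymm_le_choose_mul_prod_getD {l : List ℝ} (hl : l.Pairwise (· ≥ ·))
    (h0 : ∀ x ∈ l, 0 ≤ x) (k : ℕ) :
    (l : Multiset ℝ).esymm k ≤ l.length.choose k * ∏ i ∈ Finset.range k, l.getD i 0 := by
  induction l generalizing k with
  | nil =>
    rcases k with _ | k
    · simp [Multiset.esymm]
    · simp [Multiset.esymm, Multiset.powersetCard_zero_right]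
  | cons a l ih =>
    rcases k with _ | k
    · simp [Multiset.esymm]
    rw [List.pairwise_cons] at hl
    have h1 : ∀ x ∈ l, 0 ≤ x := fun x hx => h0 x (List.mem_cons_of_mem a hx)
    have ha := h0 a List.mem_cons_self
    have hP : 0 ≤ ∏ i ∈ Finset.range k, l.getD i 0 := Finset.prod_nonneg fun i _ => getD_nonneg h1 i
    -- The index k may run past the end of `l`; the default 0 is then still at most `a`.
    have hle : l.getD k 0 ≤ a := by
      rcases lt_or_ge k l.length with hi | hi
      · rw [List.getD_eq_getElem _ _ hi]
        exact hl.1 _ (List.getElem_mem hi)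
      · rwa [List.getD_eq_default _ _ hi]
    rw [← Multiset.cons_coe, multiset_esymm_cons, Finset.prod_range_succ']
    simp only [List.getD_cons_succ, List.getD_cons_zero, List.length_cons]
    have h2 := mul_le_mul_of_nonneg_left (ih hl.2 h1 k) ha
    have h3 := ih hl.2 h1 (k + 1)
    rw [Finset.prod_range_succ] at h3
    have h4 : (l.length.choose (k + 1) : ℝ) *
        ((∏ i ∈ Finset.range k, l.getD i 0) * l.getD k 0) ≤
        l.length.choose (k + 1) * ((∏ i ∈ Finset.range k, l.getD i 0) * a) := by gcongr
    rw [Nat.choose_succ_succ']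
    push_cast
    linarith

theorem orderedRoot_nonneg {d : ℕ} {p : ℝ[X]} (hp : p ∈ polys d (Set.Ici 0)) (i : ℕ) :
    0 ≤ orderedRoot p i :=
  getD_nonneg (fun x hx => hp.2.2.2 x (isRoot_of_mem_roots (by simpa using hx))) i

theorem orderedRoot_antitone {d : ℕ} {p : ℝ[X]} (hp : p ∈ polys d (Set.Ici 0)) {i j : ℕ}
    (hij : i ≤ j) : orderedRoot p j ≤ orderedRoot p i := by
  rcases hij.eq_or_lt with rfl | hij
  · exact le_rfl
  rcases lt_or_ge j (p.roots.sort (· ≥ ·)).length with hj | hj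
  · rw [orderedRoot, orderedRoot, List.getD_eq_getElem _ _ hj,
      List.getD_eq_getElem _ _ (hij.trans hj)]
    exact List.pairwise_iff_getElem.1 (p.roots.pairwise_sort (· ≥ ·)) i j _ _ hij
  · conv_lhs => rw [orderedRoot, List.getD_eq_default _ _ hj]
    exact orderedRoot_nonneg hp i

theorem normCoeff_le_prod_orderedRoot {d : ℕ} {p : ℝ[X]} (hp : p ∈ polys d (Set.Ici 0)) {k : ℕ}
    (hk : k ≤ d) : normCoeff d p k ≤ ∏ i ∈ Finset.range k, orderedRoot p i := by
  have hc : (0 : ℝ) < d.choose k := by exact_mod_cast Nat.choose_pos hk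
  rw [normCoeff_eq_esymm (polys_mono (Set.subset_univ _) hp) hk, div_le_iff₀' hc]
  have := esymm_le_choose_mul_prod_getD (p.roots.pairwise_sort (· ≥ ·))
    (fun x hx => hp.2.2.2 x (isRoot_of_mem_roots (by simpa using hx))) k
  rwa [Multiset.sort_eq, Multiset.length_sort, card_roots_of_mem_polys hp] at this

theorem prod_orderedRoot_le_choose_mul_normCoeff {d : ℕ} {p : ℝ[X]}
    (hp : p ∈ polys d (Set.Ici 0)) {k : ℕ} (hk : k ≤ d) :
    ∏ i ∈ Finset.range k, orderedRoot p i ≤ d.choose k * normCoeff d p k := by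
  have hc : (d.choose k : ℝ) ≠ 0 := by exact_mod_cast (Nat.choose_pos hk).ne'
  rw [normCoeff_eq_esymm (polys_mono (Set.subset_univ _) hp) hk, mul_div_cancel₀ _ hc]
  have := prod_getD_le_esymm (l := p.roots.sort (· ≥ ·)) (k := k)
    (fun x hx => hp.2.2.2 x (isRoot_of_mem_roots (by simpa using hx)))
    (by rwa [Multiset.length_sort, card_roots_of_mem_polys hp])
  rwa [Multiset.sort_eq] at this

/-- The product lies between ẽ_k and C(d,k)^(1/n) ẽ_k, because the normalized coefficient of the
n-th power is ẽ_kⁿ. -/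
theorem tendsto_prod_orderedRoot_mulConvPow {d : ℕ} {p : ℝ[X]} (hp : p ∈ polys d (Set.Ici 0))
    {k : ℕ} (hk : k ≤ d) :
    Tendsto (fun n : ℕ => ∏ i ∈ Finset.range k, orderedRoot (mulConvPow d p n) i ^ (1 / (n : ℝ)))
      atTop (𝓝 (normCoeff d p k)) := by
  have he := normCoeff_nonneg hp hk
  have hc : (0 : ℝ) < d.choose k := by exact_mod_cast Nat.choose_pos hk
  have hup : Tendsto (fun n : ℕ => (d.choose k : ℝ) ^ (1 / (n : ℝ)) * normCoeff d p k) atTop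
      (𝓝 (normCoeff d p k)) := by
    have h1 := (Real.continuousAt_const_rpow hc.ne').tendsto.comp
      (tendsto_one_div_atTop_nhds_zero_nat (𝕜 := ℝ))
    have h2 := h1.mul_const (normCoeff d p k)
    rwa [Real.rpow_zero, one_mul] at h2
  have hprod : ∀ n : ℕ, ∏ i ∈ Finset.range k, orderedRoot (mulConvPow d p n) i ^ (1 / (n : ℝ)) =
      (∏ i ∈ Finset.range k, orderedRoot (mulConvPow d p n) i) ^ (1 / (n : ℝ)) := fun n =>
    Real.finsetProd_rpow _ _ (fun i _ => orderedRoot_nonneg (mulConvPow_mem_polys hp n) i) _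
  have hpow : ∀ n : ℕ, n ≠ 0 → (normCoeff d p k ^ n) ^ (1 / (n : ℝ)) = normCoeff d p k := by
    intro n hn
    rw [one_div, Real.pow_rpow_inv_natCast he hn]
  refine tendsto_of_tendsto_of_tendsto_of_le_of_le' tendsto_const_nhds hup ?_ ?_
  · filter_upwards [eventually_ne_atTop 0] with n hn
    have h1 := normCoeff_le_prod_orderedRoot (mulConvPow_mem_polys hp n) hk
    rw [normCoeff_mulConvPow p n hk] at h1
    rw [hprod]
    nth_rewrite 1 [← hpow n hn]
    exact Real.rpow_le_rpow (pow_nonneg he n) h1 (by positivity)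
  · filter_upwards [eventually_ne_atTop 0] with n hn
    have h1 := prod_orderedRoot_le_choose_mul_normCoeff (mulConvPow_mem_polys hp n) hk
    rw [normCoeff_mulConvPow p n hk] at h1
    rw [hprod]
    conv_rhs => rw [← hpow n hn]
    rw [← Real.mul_rpow hc.le (pow_nonneg he n)]
    exact Real.rpow_le_rpow (Finset.prod_nonneg fun i _ =>
      orderedRoot_nonneg (mulConvPow_mem_polys hp n) i) h1 (by positivity)

/-- The roots of `Φ_d(p)`; a quotient with denominator `0` stands for the root `0`. -/
noncomputable def limitRoot (d : ℕ) (p : ℝ[X]) (i : ℕ) : ℝ :=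
  normCoeff d p (i + 1) / normCoeff d p i

theorem tendsto_orderedRoot_mulConvPow {d : ℕ} {p : ℝ[X]} (hp : p ∈ polys d (Set.Ici 0))
    {i : ℕ} (hi : i < d) :
    Tendsto (fun n : ℕ => orderedRoot (mulConvPow d p n) i ^ (1 / (n : ℝ))) atTop
      (𝓝 (limitRoot d p i)) := by
  -- If ẽ_i = 0, the product of the i largest roots of each positive power vanishes, so the next
  -- root is 0 as well, in agreement with division by zero being 0.
  rcases (normCoeff_nonneg hp hi.le).eq_or_lt with h0 | hpos
  · rw [limitRoot, ← h0, div_zero]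
    refine tendsto_const_nhds.congr' ?_
    filter_upwards [eventually_ne_atTop 0] with n hn
    have hg := mulConvPow_mem_polys hp n
    have h1 := prod_orderedRoot_le_choose_mul_normCoeff hg hi.le
    rw [normCoeff_mulConvPow p n hi.le, ← h0, zero_pow hn, mul_zero] at h1
    obtain ⟨j, hj, hj0⟩ := Finset.prod_eq_zero_iff.1
      (h1.antisymm (Finset.prod_nonneg fun i _ => orderedRoot_nonneg hg i))
    have h2 := orderedRoot_antitone hg (Finset.mem_range.1 hj).le
    rw [hj0] at h2
    have hn' : (n : ℝ) ≠ 0 := by exact_mod_cast hn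
    rw [h2.antisymm (orderedRoot_nonneg hg i), Real.zero_rpow (one_div_ne_zero hn')]
  · have h1 := tendsto_prod_orderedRoot_mulConvPow hp hi.le
    have h2 := tendsto_prod_orderedRoot_mulConvPow hp (Nat.succ_le_of_lt hi)
    refine (h2.div h1 hpos.ne').congr' ?_
    filter_upwards [h1.eventually_ne hpos.ne'] with n hn
    rw [Pi.div_apply, Finset.prod_range_succ, mul_div_cancel_left₀ _ hn]

theorem roots_eq_map_orderedRoot {d : ℕ} {K : Set ℝ} {p : ℝ[X]} (hp : p ∈ polys d K) :
    p.roots = (Finset.range d).val.map (orderedRoot p) := by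
  have h : p.roots.sort (· ≥ ·) = (List.range d).map (orderedRoot p) := by
    have hlen : (p.roots.sort (· ≥ ·)).length = d := by
      rw [Multiset.length_sort, card_roots_of_mem_polys hp]
    refine List.ext_getElem (by simpa using hlen) fun i hi _ => ?_
    rw [List.getElem_map, List.getElem_range, orderedRoot, List.getD_eq_getElem _ _ hi]
  rw [← p.roots.sort_eq (· ≥ ·), h]
  rfl

theorem phiSeq_eq_prod {d : ℕ} {p : ℝ[X]} (hp : p ∈ polys d (Set.Ici 0)) (n : ℕ) :
    phiSeq d p n =
      ∏ i ∈ Finset.range d, (X - C (orderedRoot (mulConvPow d p n) i ^ (1 / (n : ℝ)))) := by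
  rw [phiSeq, rootPow, roots_eq_map_orderedRoot (mulConvPow_mem_polys hp n), Multiset.map_map]
  rfl

theorem polyTendsto_prod {d : ℕ} {a : ℕ → ℕ → ℝ} {b : ℕ → ℝ}
    (h : ∀ i < d, Tendsto (a i) atTop (𝓝 (b i))) :
    PolyTendsto (fun n => ∏ i ∈ Finset.range d, (X - C (a i n)))
      (∏ i ∈ Finset.range d, (X - C (b i))) := by
  induction d with
  | zero => intro k; simp
  | succ d ih =>
    have ih' := ih fun i hi => h i (by omega)
    have hd := h d (by omega)
    intro k
    simp only [Finset.prod_range_succ]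
    rcases k with _ | k
    · simp only [mul_coeff_zero, coeff_sub, coeff_X_zero, coeff_C_zero]
      exact (ih' 0).mul (tendsto_const_nhds.sub hd)
    · simp only [coeff_mul_X_sub_C]
      exact (ih' k).sub ((ih' (k + 1)).mul hd)

theorem polyTendsto_phiSeq {d : ℕ} {p : ℝ[X]} (hp : p ∈ polys d (Set.Ici 0)) :
    PolyTendsto (phiSeq d p) (∏ i ∈ Finset.range d, (X - C (limitRoot d p i))) := by
  rw [funext (phiSeq_eq_prod hp)]
  exact polyTendsto_prod fun i hi => tendsto_orderedRoot_mulConvPow hp hi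

theorem Phi_eq_prod {d : ℕ} {p : ℝ[X]} (hp : p ∈ polys d (Set.Ici 0)) :
    Phi d p = ∏ i ∈ Finset.range d, (X - C (limitRoot d p i)) := by
  have hdeg : (∏ i ∈ Finset.range d, (X - C (limitRoot d p i))).natDegree = d := by
    rw [natDegree_prod_of_monic _ _ fun i _ => monic_X_sub_C _]; simp
  rw [Phi, as_sum_range' (∏ i ∈ Finset.range d, (X - C (limitRoot d p i))) (d + 1) (by omega)]
  exact Finset.sum_congr rfl fun k _ => by rw [(polyTendsto_phiSeq hp k).limUnder_eq]

theorem roots_Phi {d : ℕ} {p : ℝ[X]} (hp : p ∈ polys d (Set.Ici 0)) :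
    (Phi d p).roots = (Finset.range d).val.map (limitRoot d p) := by
  rw [Phi_eq_prod hp]
  have := roots_multiset_prod_X_sub_C ((Finset.range d).val.map (limitRoot d p))
  rwa [Multiset.map_map] at this

theorem Phi_mem_polys {d : ℕ} {p : ℝ[X]} (hp : p ∈ polys d (Set.Ici 0)) :
    Phi d p ∈ polys d (Set.Ici 0) := by
  have hm : (Phi d p).Monic := by
    rw [Phi_eq_prod hp]; exact monic_prod_of_monic _ _ fun i _ => monic_X_sub_C _
  refine ⟨hm, ?_, ?_, fun x hx => ?_⟩
  · rw [Phi_eq_prod hp, natDegree_prod_of_monic _ _ fun i _ => monic_X_sub_C _]; simp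
  · rw [Phi_eq_prod hp]; exact Splits.prod fun i _ => Splits.X_sub_C _
  · have h1 := (mem_roots hm.ne_zero).2 hx
    rw [roots_Phi hp] at h1
    obtain ⟨i, hi, rfl⟩ := Multiset.mem_map.1 h1
    have hi' : i < d := by simpa using hi
    exact div_nonneg (normCoeff_nonneg hp hi') (normCoeff_nonneg hp hi'.le)

theorem RootLE.limitRoot_le {d : ℕ} {p q : ℝ[X]} (h : RootLE d p q)
    (hp : p ∈ polys d (Set.Ici 0)) (hq : q ∈ polys d (Set.Ici 0)) {i : ℕ} (hi : i < d) :
    limitRoot d p i ≤ limitRoot d q i :=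
  le_of_tendsto_of_tendsto' (tendsto_orderedRoot_mulConvPow hp hi)
    (tendsto_orderedRoot_mulConvPow hq hi) fun n =>
      Real.rpow_le_rpow (orderedRoot_nonneg (mulConvPow_mem_polys hp n) i)
        ((h.mulConvPow hp hq n).2.2 i hi) (by positivity)

/-- Counting roots above a threshold only needs the termwise inequality of `limitRoot`, so that
sequence need not be shown to be decreasing. -/
theorem RootLE.Phi {d : ℕ} {p q : ℝ[X]} (h : RootLE d p q)
    (hp : p ∈ polys d (Set.Ici 0)) (hq : q ∈ polys d (Set.Ici 0)) :
    RootLE d (Phi d p) (Phi d q) := by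
  refine rootLE_of_countP_le (polys_mono (Set.subset_univ _) (Phi_mem_polys hp))
    (polys_mono (Set.subset_univ _) (Phi_mem_polys hq)) fun x _ _ => ?_
  rw [roots_Phi hp, roots_Phi hq, Multiset.countP_map, Multiset.countP_map]
  refine Finset.card_le_card (s := (Finset.range d).filter fun i => x < limitRoot d p i)
    (t := (Finset.range d).filter fun i => x < limitRoot d q i) fun i hi => ?_
  rw [Finset.mem_filter, Finset.mem_range] at hi ⊢
  exact ⟨hi.1, hi.2.trans_le (h.limitRoot_le hp hq hi.1)⟩

end FiniteFree

theorem theorem4p2 (d : ℕ) (p q : Polynomial ℝ) (hpq : FiniteFree.RootLE d p q) :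
    (∀ r ∈ FiniteFree.polys d Set.univ,
      FiniteFree.RootLE d (FiniteFree.addConv d p r) (FiniteFree.addConv d q r)) ∧
    (∀ r ∈ FiniteFree.polys d (Set.Ici 0),
      FiniteFree.RootLE d (FiniteFree.mulConv d p r) (FiniteFree.mulConv d q r)) ∧
    (∀ k : ℕ, 1 ≤ k → k ≤ d →
      FiniteFree.RootLE k (FiniteFree.normDeriv d k p) (FiniteFree.normDeriv d k q)) ∧
    (p ∈ FiniteFree.polys d (Set.Ici 0) → q ∈ FiniteFree.polys d (Set.Ici 0) →
      FiniteFree.PolyTendsto (FiniteFree.phiSeq d p) (FiniteFree.Phi d p) ∧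
      FiniteFree.PolyTendsto (FiniteFree.phiSeq d q) (FiniteFree.Phi d q) ∧
      FiniteFree.Phi d p ∈ FiniteFree.polys d (Set.Ici 0) ∧
      FiniteFree.Phi d q ∈ FiniteFree.polys d (Set.Ici 0) ∧
      FiniteFree.RootLE d (FiniteFree.Phi d p) (FiniteFree.Phi d q)) := by
  refine ⟨fun r hr => (FiniteFree.preservesStability_addConv hr).rootLE hpq,
    fun r hr => (FiniteFree.preservesStability_mulConv hr).rootLE hpq,
    fun k _ hk => (FiniteFree.preservesStability_normDeriv hk).rootLE hpq,
    fun hp hq => ⟨?_, ?_, FiniteFree.Phi_mem_polys hp, FiniteFree.Phi_mem_polys hq,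
      hpq.Phi hp hq⟩⟩
  · rw [FiniteFree.Phi_eq_prod hp]
    exact FiniteFree.polyTendsto_phiSeq hp
  · rw [FiniteFree.Phi_eq_prod hq]
    exact FiniteFree.polyTendsto_phiSeq hq
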